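/- Let $r\ge 1$ and let $V=\mathbb{R}^r$ with the standard inner product $\langle\cdot,\cdot\rangle$. Let $\Lambda\subset(\mathbb{Z}^r\setminus\{\vec 0\})\times\mathbb{C}$ be a finite set. Regard $f=(\vec f,\overset{\circ}{f})\in\Lambda$ as the affine functional $f(\mathbf v)=\langle\vec f,\mathbf v\rangle+\overset{\circ}{f}$ on $V$. Assume that the subgroup of $\mathbb{Z}^r$ generated by the vectors $\vec f$ $(f\in\Lambda)$ has rank $r$. Let $\widetilde\Lambda$ be the set of those $f\in\Lambda$ for which the subgroup generated by the vectors $\vec g$ $(g\in\Lambda\setminus\{f\})$ has rank different from $r$, and for such $f$ let $\mathfrak{H}_{\Lambda\setminus\{f\}}=\sum_{g\in\Lambda\setminus\{f\}}\mathbb{R}\,\vec g$. For $\mathbf k=(k_f)_{f\in\Lambda}\in\mathbb{N}_0^{\sharp\Lambda}$ put $\Lambda_0=\{f\in\Lambda: k_f=0\}$, $\Lambda_1=\{f\in\Lambda: k_f=1\}$ and $\Lambda_+=\{f\in\Lambda: k_f>0\}$, and for $N\in\mathbb{N}$ and $\mathbf y\in V$ let $$Z(N;\mathbf k,\mathbf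 y;\Lambda)=(-1)^{\sharp\Lambda_0}\sum_{\substack{\mathbf v=(v_1,\dots,v_r)\in\mathbb{Z}^r\\ |v_j|\le N\ (1\le j\le r)\\ f(\mathbf v)\ne0\ (f\in\Lambda_+)\\ f(\mathbf v)=0\ (f\in\Lambda_0)}}e^{2\pi\sqrt{-1}\langle\mathbf y,\mathbf v\rangle}\prod_{f\in\Lambda_+}\frac1{f(\mathbf v)^{k_f}} .$$ **Theorem.** For every $\mathbf k\in\mathbb{N}_0^{\sharp\Lambda}$ and every $\mathbf y\in V\setminus\bigcup_{f\in\widetilde\Lambda\cap\Lambda_1}(\mathfrak{H}_{\Lambda\setminus\{f\}}+\mathbb{Z}^r)$ the limit $$S(\mathbf k,\mathbf y;\Lambda)=\lim_{N\to\infty}Z(N;\mathbf k,\mathbf y;\Lambda)$$ exists, and $\mathbf y\mapsto S(\mathbf k,\mathbf y;\Lambda)$ is continuous on $V\setminus\bigcup_{f\in\widetilde\Lambda\cap\Lambda_1}(\mathfrak{H}_{\Lambda\setminus\{f\}}+\mathbb{Z}^r)$. -/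

import Mathlib

open Filter Topology
open scoped Pointwise

/-- Pairs `f = (f⃗, c)` with `f⃗ ∈ ℤ^r` and `c ∈ ℂ`, the data of an affine functional
`v ↦ ⟨f⃗, v⟩ + c` on `V = ℝ^r`. -/
abbrev AffFun (r : ℕ) : Type := (Fin r → ℤ) × ℂ

/-- An integer vector, regarded as an element of `V = ℝ^r`. -/
noncomputable def intVec {r : ℕ} (v : Fin r → ℤ) : EuclideanSpace ℝ (Fin r) :=
  WithLp.toLp 2 (fun j => (v j : ℝ))

namespace AffFun

variable {r : ℕ}

/-- The linear part `f⃗`, as a vector of `V`. -/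
noncomputable def vec (f : AffFun r) : EuclideanSpace ℝ (Fin r) := intVec f.1

/-- The value `f(v) = ⟨f⃗, v⟩ + c`. -/
noncomputable def eval (f : AffFun r) (v : EuclideanSpace ℝ (Fin r)) : ℂ :=
  ((inner ℝ f.vec v : ℝ) : ℂ) + f.2

end AffFun

/-- The rank of the subgroup of `ℤ^r` generated by the linear parts of the members of `H`. -/
noncomputable def vecRank {r : ℕ} (H : Set (AffFun r)) : ℕ :=
  Module.finrank ℤ (Submodule.span ℤ ((fun f : AffFun r => f.1) '' H))

/-- The real span `𝔥_H` of the linear parts of the members of `H`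
(a hyperplane when `vecRank H = r - 1`). -/
noncomputable def realSpan {r : ℕ} (H : Set (AffFun r)) :
    Submodule ℝ (EuclideanSpace ℝ (Fin r)) :=
  Submodule.span ℝ (AffFun.vec '' H)

/-- The set `Λ̃` of those `f ∈ Λ` without which the linear parts have rank different from `r`. -/
def indispensable {r : ℕ} (Λ : Finset (AffFun r)) : Set (AffFun r) :=
  {f | f ∈ Λ ∧ vecRank ((Λ : Set (AffFun r)) \ {f}) ≠ r}

/-- The set `V ∖ ⋃_{f ∈ Λ̃ ∩ Λ_1} (𝔥_{Λ∖{f}} + ℤ^r)`. -/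
def regularSet {r : ℕ} (Λ : Finset (AffFun r)) (k : Λ → ℕ) : Set (EuclideanSpace ℝ (Fin r)) :=
  (⋃ f : Λ, ⋃ _ : (f : AffFun r) ∈ indispensable Λ ∧ k f = 1,
    ((realSpan ((Λ : Set (AffFun r)) \ {(f : AffFun r)}) : Set (EuclideanSpace ℝ (Fin r))) +
      Set.range (intVec : (Fin r → ℤ) → EuclideanSpace ℝ (Fin r))))ᶜ

open Classical in
/-- The integer points `v` with `|v_j| ≤ N` for all `j`, with `f(v) ≠ 0` whenever `k_f > 0`
and `f(v) = 0` whenever `k_f = 0`. -/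
noncomputable def latticeBox {r : ℕ} (Λ : Finset (AffFun r)) (k : Λ → ℕ) (N : ℕ) :
    Finset (Fin r → ℤ) :=
  (Fintype.piFinset fun _ : Fin r => Finset.Icc (-(N : ℤ)) (N : ℤ)).filter fun v =>
    (∀ f : Λ, 0 < k f → (f : AffFun r).eval (intVec v) ≠ 0) ∧
    (∀ f : Λ, k f = 0 → (f : AffFun r).eval (intVec v) = 0)

/-- The truncated sum `Z(N; k, y; Λ)`. -/
noncomputable def truncSum {r : ℕ} (Λ : Finset (AffFun r)) (k : Λ → ℕ) (N : ℕ)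
    (y : EuclideanSpace ℝ (Fin r)) : ℂ :=
  (-1) ^ (Finset.univ.filter fun f : Λ => k f = 0).card *
    ∑ v ∈ latticeBox Λ k N,
      Complex.exp (2 * Real.pi * Complex.I * ((inner ℝ y (intVec v) : ℝ) : ℂ)) *
        ∏ f : Λ with 0 < k f, 1 / (f : AffFun r).eval (intVec v) ^ k f

/-- The lattice sum `S(k, y; Λ) = lim_{N → ∞} Z(N; k, y; Λ)`. -/
noncomputable def latticeSum {r : ℕ} (Λ : Finset (AffFun r)) (k : Λ → ℕ)
    (y : EuclideanSpace ℝ (Fin r)) : ℂ :=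
  limUnder atTop fun N : ℕ => truncSum Λ k N y

/-- The weight `1 + |n|` of an integer. -/
noncomputable def intWt (n : ℤ) : ℝ := 1 + |(n : ℝ)|

lemma one_le_intWt (n : ℤ) : 1 ≤ intWt n := by
  unfold intWt; linarith [abs_nonneg (n : ℝ)]

lemma intWt_pos (n : ℤ) : 0 < intWt n := lt_of_lt_of_le one_pos (one_le_intWt n)

lemma summable_intWt_rpow {p : ℝ} (hp : 1 < p) : Summable fun n : ℤ => intWt n ^ (-p) := by
  refine Summable.of_norm_bounded_eventually (Real.summable_abs_int_rpow hp) ?_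
  have h0 : ∀ᶠ n : ℤ in cofinite, n ≠ 0 := by
    simpa using (Set.finite_singleton (0 : ℤ)).compl_mem_cofinite
  filter_upwards [h0] with n hn
  have hn' : 0 < |(n : ℝ)| := by positivity
  rw [Real.norm_of_nonneg (Real.rpow_nonneg (intWt_pos n).le _)]
  exact Real.rpow_le_rpow_of_nonpos hn' (by unfold intWt; linarith) (by linarith)

lemma sum_prod_le_tsum_pow {κ : Type*} [Fintype κ] {g : ℤ → ℝ} (hg : 0 ≤ g) (hs : Summable g)
    (A : Finset (κ → ℤ)) : ∑ n ∈ A, ∏ i, g (n i) ≤ (∑' n, g n) ^ Fintype.card κ := by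
  classical
  have hsub : A ⊆ Fintype.piFinset fun i => A.image fun n => n i := fun n hn =>
    Fintype.mem_piFinset.2 fun i => Finset.mem_image_of_mem _ hn
  calc ∑ n ∈ A, ∏ i, g (n i)
      ≤ ∑ n ∈ Fintype.piFinset fun i => A.image fun n => n i, ∏ i, g (n i) :=
        Finset.sum_le_sum_of_subset_of_nonneg hsub
          fun n _ _ => Finset.prod_nonneg fun i _ => hg _
    _ = ∏ i, ∑ x ∈ A.image fun n => n i, g x := (Finset.prod_univ_sum _ fun _ => g).symm
    _ ≤ ∏ _i : κ, ∑' n, g n := Finset.prod_le_prod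
        (fun i _ => Finset.sum_nonneg fun x _ => hg x)
        fun i _ => hs.sum_le_tsum _ fun x _ => hg x
    _ = _ := by simp

section

variable {ι : Type*} {r : ℕ}

lemma sum_prod_intWt_le_of_injOn {a : ι → Fin r → ℤ} {s : Finset ι} {p : ℝ} (hp : 1 < p)
    {A : Finset (Fin r → ℤ)}
    (hA : ∀ u ∈ A, ∀ v ∈ A, (∀ i ∈ s, a i ⬝ᵥ u = a i ⬝ᵥ v) → u = v) :
    ∑ v ∈ A, ∏ i ∈ s, intWt (a i ⬝ᵥ v) ^ (-p) ≤ (∑' n : ℤ, intWt n ^ (-p)) ^ s.card := by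
  classical
  have hinj : Set.InjOn (fun (v : Fin r → ℤ) (i : s) => a i ⬝ᵥ v) A := fun u hu v hv h =>
    hA u hu v hv fun i hi => congrFun h ⟨i, hi⟩
  have := sum_prod_le_tsum_pow (κ := s) (g := fun n : ℤ => intWt n ^ (-p))
    (fun n => Real.rpow_nonneg (intWt_pos n).le _) (summable_intWt_rpow hp)
    (A.image fun v i => a i ⬝ᵥ v)
  rw [Finset.sum_image hinj, Fintype.card_coe] at this
  refine le_trans (le_of_eq (Finset.sum_congr rfl fun v _ => ?_)) this
  exact (Finset.prod_coe_sort s fun i => intWt (a i ⬝ᵥ v) ^ (-p)).symm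

/-- Every coordinate functional is a real combination of the functionals `⟨a i, ·⟩`, `i ∈ s`. -/
def SpansCoords (a : ι → Fin r → ℤ) (s : Finset ι) : Prop :=
  ∀ j, ∃ c : ι → ℝ, ∀ u : Fin r → ℤ, (u j : ℝ) = ∑ i ∈ s, c i * ((a i ⬝ᵥ u : ℤ) : ℝ)

lemma SpansCoords.eq_of_forall {a : ι → Fin r → ℤ} {s : Finset ι} (h : SpansCoords a s)
    {u v : Fin r → ℤ} (huv : ∀ i ∈ s, a i ⬝ᵥ u = a i ⬝ᵥ v) : u = v := by
  funext j
  obtain ⟨c, hc⟩ := h j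
  have : (u j : ℝ) = v j := by
    rw [hc u, hc v]
    exact Finset.sum_congr rfl fun i hi => by rw [huv i hi]
  exact_mod_cast this

lemma SpansCoords.summable {a : ι → Fin r → ℤ} {s : Finset ι} (h : SpansCoords a s)
    {p : ℝ} (hp : 1 < p) :
    Summable fun v : Fin r → ℤ => ∏ i ∈ s, intWt (a i ⬝ᵥ v) ^ (-p) :=
  summable_of_sum_le (fun _ => Finset.prod_nonneg fun _ _ => Real.rpow_nonneg (intWt_pos _).le _)
    fun _ => sum_prod_intWt_le_of_injOn hp fun _ _ _ _ huv => h.eq_of_forall huv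

variable [Fintype ι]

/-- Absolute convergence when each functional is either dispensable or counted twice. -/
lemma summable_prod_intWt [DecidableEq ι] {a : ι → Fin r → ℤ} (hι : Nonempty ι)
    (hsp : SpansCoords a Finset.univ) {e : ι → ℕ} (he : ∀ i, 1 ≤ e i)
    (h : ∀ i, SpansCoords a (Finset.univ.erase i) ∨ 2 ≤ e i) :
    Summable fun v : Fin r → ℤ => ∏ i, (intWt (a i ⬝ᵥ v))⁻¹ ^ e i := by
  classical
  set m : ℕ := Fintype.card ι with hm
  have hm0 : 0 < (m : ℝ) := by
    have : 0 < m := Fintype.card_pos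
    exact_mod_cast this
  set p : ℝ := 1 + 1 / m with hpdef
  have hp : 1 < p := by
    have : 0 < 1 / (m : ℝ) := by positivity
    linarith
  let B : ι → Finset ι := fun i => if 2 ≤ e i then Finset.univ else Finset.univ.erase i
  have hB : ∀ i, SpansCoords a (B i) := by
    intro i
    by_cases h2 : 2 ≤ e i
    · simpa [B, h2] using hsp
    · simpa [B, h2] using (h i).resolve_right h2
  have key : ∀ x : ι → ℝ, (∀ i, 1 ≤ x i) →
      ∏ i, (x i)⁻¹ ^ e i ≤ ∑ j, ∏ i ∈ B j, x i ^ (-p) := by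
    intro x hx
    have hx0 : ∀ i, 0 < x i := fun i => lt_of_lt_of_le one_pos (hx i)
    obtain ⟨j, -, hj⟩ := Finset.exists_max_image Finset.univ x Finset.univ_nonempty
    have hsplit : ∀ i, x i ^ (-p) = (x i)⁻¹ * x i ^ (-(1 / m : ℝ)) := by
      intro i
      rw [hpdef, neg_add, Real.rpow_add (hx0 i), Real.rpow_neg_one]
    have hpow : (x j)⁻¹ ≤ ∏ i ∈ B j, x i ^ (-(1 / m : ℝ)) := by
      calc (x j)⁻¹ = ∏ _i : ι, x j ^ (-(1 / m : ℝ)) := by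
            rw [Finset.prod_const, Finset.card_univ, ← hm, ← Real.rpow_natCast,
              ← Real.rpow_mul (hx0 j).le, ← Real.rpow_neg_one]
            congr 1; field_simp
        _ ≤ ∏ i ∈ B j, x j ^ (-(1 / m : ℝ)) := by
            refine Finset.prod_le_prod_of_subset_of_le_one (Finset.subset_univ _)
              (fun i _ => Real.rpow_nonneg (hx0 j).le _) fun i _ _ => ?_
            exact Real.rpow_le_one_of_one_le_of_nonpos (hx j) (by simp)
        _ ≤ _ := Finset.prod_le_prod (fun i _ => Real.rpow_nonneg (hx0 j).le _) fun i _ =>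
            Real.rpow_le_rpow_of_nonpos (hx0 i) (hj i (Finset.mem_univ i))
              (by simp)
    have hmain : ∏ i, (x i)⁻¹ ^ e i ≤ (x j)⁻¹ * ∏ i ∈ B j, (x i)⁻¹ := by
      have h1 : ∀ i, (x i)⁻¹ ^ e i ≤ (x i)⁻¹ := fun i =>
        pow_le_of_le_one (inv_nonneg.2 (hx0 i).le) (inv_le_one_of_one_le₀ (hx i))
          (by have := he i; omega)
      rw [← Finset.mul_prod_erase _ _ (Finset.mem_univ j)]
      by_cases h2 : 2 ≤ e j
      · simp only [B, h2, if_true]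
        rw [← Finset.mul_prod_erase Finset.univ (fun i => (x i)⁻¹) (Finset.mem_univ j), ← mul_assoc]
        refine mul_le_mul ?_ ?_ ?_ ?_
        · rw [← pow_two]
          exact pow_le_pow_of_le_one (inv_nonneg.2 (hx0 j).le) (inv_le_one_of_one_le₀ (hx j)) h2
        · exact Finset.prod_le_prod (fun i _ => pow_nonneg (inv_nonneg.2 (hx0 i).le) _)
            fun i _ => h1 i
        · exact Finset.prod_nonneg fun i _ => pow_nonneg (inv_nonneg.2 (hx0 i).le) _
        · exact mul_nonneg (inv_nonneg.2 (hx0 j).le) (inv_nonneg.2 (hx0 j).le)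
      · simp only [B, h2, if_false]
        refine mul_le_mul (h1 j) ?_ ?_ (inv_nonneg.2 (hx0 j).le)
        · exact Finset.prod_le_prod (fun i _ => pow_nonneg (inv_nonneg.2 (hx0 i).le) _)
            fun i _ => h1 i
        · exact Finset.prod_nonneg fun i _ => pow_nonneg (inv_nonneg.2 (hx0 i).le) _
    calc ∏ i, (x i)⁻¹ ^ e i ≤ (x j)⁻¹ * ∏ i ∈ B j, (x i)⁻¹ := hmain
      _ ≤ (∏ i ∈ B j, x i ^ (-(1 / m : ℝ))) * ∏ i ∈ B j, (x i)⁻¹ :=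
        mul_le_mul_of_nonneg_right hpow (Finset.prod_nonneg fun i _ => inv_nonneg.2 (hx0 i).le)
      _ = ∏ i ∈ B j, x i ^ (-p) := by
        rw [mul_comm, ← Finset.prod_mul_distrib]
        exact Finset.prod_congr rfl fun i _ => (hsplit i).symm
      _ ≤ _ := Finset.single_le_sum (f := fun j => ∏ i ∈ B j, x i ^ (-p))
        (fun j _ => Finset.prod_nonneg fun i _ => Real.rpow_nonneg (hx0 i).le _)
        (Finset.mem_univ j)
  refine Summable.of_nonneg_of_le
    (fun v => Finset.prod_nonneg fun i _ => pow_nonneg (inv_nonneg.2 (intWt_pos _).le) _)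
    (fun v => key (fun i => intWt (a i ⬝ᵥ v)) fun i => one_le_intWt _)
    (summable_sum fun j _ => (hB j).summable hp)

/-- The cube of lattice points with coordinates bounded by `N`. -/
noncomputable def cube (r N : ℕ) : Finset (Fin r → ℤ) :=
  Fintype.piFinset fun _ : Fin r => Finset.Icc (-(N : ℤ)) (N : ℤ)

lemma mem_cube {N : ℕ} {u : Fin r → ℤ} : u ∈ cube r N ↔ ∀ j, |u j| ≤ N := by
  simp [cube, Fintype.mem_piFinset, abs_le]

lemma exists_intWt_le_on_cube (a : ι → Fin r → ℤ) :
    ∃ A : ℝ, 1 ≤ A ∧ ∀ N : ℕ, ∀ u ∈ cube r N, ∀ i, intWt (a i ⬝ᵥ u) ≤ A * (1 + N) := by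
  refine ⟨1 + ∑ i, ∑ j, |(a i j : ℝ)|, ?_, ?_⟩
  · have : 0 ≤ ∑ i, ∑ j, |(a i j : ℝ)| :=
      Finset.sum_nonneg fun i _ => Finset.sum_nonneg fun j _ => abs_nonneg _
    linarith
  intro N u hu i
  have h1 : |((a i ⬝ᵥ u : ℤ) : ℝ)| ≤ (∑ j, |(a i j : ℝ)|) * N := by
    rw [dotProduct, Finset.sum_mul]
    push_cast
    refine (Finset.abs_sum_le_sum_abs _ _).trans (Finset.sum_le_sum fun j _ => ?_)
    rw [abs_mul]
    have : |(u j : ℝ)| ≤ N := by exact_mod_cast mem_cube.1 hu j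
    gcongr
  have h2 : ∑ j, |(a i j : ℝ)| ≤ ∑ i, ∑ j, |(a i j : ℝ)| :=
    Finset.single_le_sum (f := fun i => ∑ j, |(a i j : ℝ)|)
      (fun i _ => Finset.sum_nonneg fun j _ => abs_nonneg _) (Finset.mem_univ i)
  have h3 : 0 ≤ ∑ j, |(a i j : ℝ)| := Finset.sum_nonneg fun j _ => abs_nonneg _
  have hN : (0 : ℝ) ≤ N := Nat.cast_nonneg N
  unfold intWt
  nlinarith

/-- On a slice `u j = t` of a cube the total weight is small. -/
lemma exists_slice_le [DecidableEq ι] {a : ι → Fin r → ℤ} (hι : Nonempty ι) (hsp : SpansCoords a Finset.univ)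
    (j : Fin r) :
    ∃ C : ℝ, 0 ≤ C ∧ ∀ (N : ℕ) (t : ℤ), ∑ u ∈ cube r N with u j = t, ∏ i, (intWt (a i ⬝ᵥ u))⁻¹ ≤
      C * (1 + N : ℝ) ^ (1 / 2 : ℝ) * (intWt t)⁻¹ := by
  obtain ⟨A, hA1, hA⟩ := exists_intWt_le_on_cube a
  obtain ⟨c, hc⟩ := hsp j
  set m : ℕ := Fintype.card ι with hm
  have hm0 : 0 < (m : ℝ) := by
    have : 0 < m := Fintype.card_pos
    exact_mod_cast this
  set δ : ℝ := 1 / (2 * m) with hδ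
  have hδ0 : 0 < δ := by positivity
  set T : ℝ := ∑' n : ℤ, intWt n ^ (-(1 + δ)) with hT
  have hT0 : 0 ≤ T := tsum_nonneg fun n => Real.rpow_nonneg (intWt_pos n).le _
  let S : Finset ι := Finset.univ.filter fun i => c i ≠ 0
  have hS : S.Nonempty := by
    by_contra hne
    have h0 : ∀ i, c i = 0 := fun i => by
      by_contra hi
      exact hne ⟨i, by simp [S, hi]⟩
    have := hc (Pi.single j 1)
    simp [h0] at this
  have hwt : ∀ u : Fin r → ℤ, intWt (u j) ≤ ∑ i ∈ S, (1 + |c i|) * intWt (a i ⬝ᵥ u) := by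
    intro u
    have h1 : |(u j : ℝ)| ≤ ∑ i ∈ S, |c i| * |((a i ⬝ᵥ u : ℤ) : ℝ)| := by
      rw [hc u, Finset.sum_filter]
      refine (Finset.abs_sum_le_sum_abs _ _).trans (Finset.sum_le_sum fun i _ => ?_)
      split_ifs with h
      · rw [abs_mul]
      · simp only [not_not] at h
        simp [h]
    have h2 : (1 : ℝ) ≤ ∑ _i ∈ S, (1 : ℝ) := by
      have := hS.card_pos
      simp only [Finset.sum_const, nsmul_eq_mul, mul_one]
      exact_mod_cast this
    have : intWt (u j) ≤ ∑ i ∈ S, (1 + |c i| * |((a i ⬝ᵥ u : ℤ) : ℝ)|) := by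
      rw [Finset.sum_add_distrib]
      exact add_le_add h2 h1
    refine this.trans (Finset.sum_le_sum fun i _ => ?_)
    unfold intWt
    nlinarith [abs_nonneg (c i), abs_nonneg ((a i ⬝ᵥ u : ℤ) : ℝ)]
  have hprod : ∀ u : Fin r → ℤ, ∏ i, (intWt (a i ⬝ᵥ u))⁻¹ ≤
      (intWt (u j))⁻¹ * ∑ i ∈ S, (1 + |c i|) * ∏ l ∈ Finset.univ.erase i, (intWt (a l ⬝ᵥ u))⁻¹ := by
    intro u
    have hP : 0 ≤ ∏ i, (intWt (a i ⬝ᵥ u))⁻¹ :=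
      Finset.prod_nonneg fun i _ => inv_nonneg.2 (intWt_pos _).le
    rw [inv_mul_eq_div, le_div_iff₀ (intWt_pos _)]
    refine (mul_le_mul_of_nonneg_left (hwt u) hP).trans (le_of_eq ?_)
    rw [Finset.mul_sum]
    refine Finset.sum_congr rfl fun i _ => ?_
    rw [← Finset.mul_prod_erase _ _ (Finset.mem_univ i)]
    have := (intWt_pos (a i ⬝ᵥ u)).ne'
    field_simp
  have herase : ∀ (N : ℕ), ∀ u ∈ cube r N, ∀ i,
      ∏ l ∈ Finset.univ.erase i, (intWt (a l ⬝ᵥ u))⁻¹ ≤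
      (A * (1 + N)) ^ (1 / 2 : ℝ) *
        ∏ l ∈ Finset.univ.erase i, intWt (a l ⬝ᵥ u) ^ (-(1 + δ)) := by
    intro N u hu i
    have hX : 1 ≤ A * (1 + N : ℝ) := by
      have : (0 : ℝ) ≤ N := Nat.cast_nonneg N
      nlinarith
    calc ∏ l ∈ Finset.univ.erase i, (intWt (a l ⬝ᵥ u))⁻¹
        ≤ ∏ l ∈ Finset.univ.erase i, ((A * (1 + N)) ^ δ * intWt (a l ⬝ᵥ u) ^ (-(1 + δ))) := by
          refine Finset.prod_le_prod (fun l _ => inv_nonneg.2 (intWt_pos _).le) fun l _ => ?_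
          have h1 : (intWt (a l ⬝ᵥ u))⁻¹ =
              intWt (a l ⬝ᵥ u) ^ δ * intWt (a l ⬝ᵥ u) ^ (-(1 + δ)) := by
            rw [← Real.rpow_add (intWt_pos _), ← Real.rpow_neg_one]
            congr 1; ring
          rw [h1]
          exact mul_le_mul_of_nonneg_right
            (Real.rpow_le_rpow (intWt_pos _).le (hA N u hu l) hδ0.le)
            (Real.rpow_nonneg (intWt_pos _).le _)
      _ = ((A * (1 + N)) ^ δ) ^ (Finset.univ.erase i).card *
            ∏ l ∈ Finset.univ.erase i, intWt (a l ⬝ᵥ u) ^ (-(1 + δ)) := by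
          rw [Finset.prod_mul_distrib, Finset.prod_const]
      _ ≤ _ := by
          refine mul_le_mul_of_nonneg_right ?_
            (Finset.prod_nonneg fun l _ => Real.rpow_nonneg (intWt_pos _).le _)
          rw [← Real.rpow_natCast, ← Real.rpow_mul (by linarith)]
          refine Real.rpow_le_rpow_of_exponent_le hX ?_
          have h1 : ((Finset.univ.erase i).card : ℝ) ≤ m := by
            exact_mod_cast (Finset.card_le_univ _)
          calc δ * ((Finset.univ.erase i).card : ℝ) ≤ δ * m :=
                mul_le_mul_of_nonneg_left h1 hδ0.le
            _ = 1 / 2 := by rw [hδ]; field_simp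
  have hslice : ∀ (N : ℕ) (t : ℤ), ∀ i ∈ S,
      ∑ u ∈ cube r N with u j = t, ∏ l ∈ Finset.univ.erase i, intWt (a l ⬝ᵥ u) ^ (-(1 + δ)) ≤
        T ^ (Finset.univ.erase i).card := by
    intro N t i hi
    refine sum_prod_intWt_le_of_injOn (by linarith) ?_
    intro u hu v hv huv
    have hci : c i ≠ 0 := by simpa [S] using hi
    have huj : (u j : ℝ) = v j := by
      rw [(Finset.mem_filter.1 hu).2, (Finset.mem_filter.1 hv).2]
    refine hsp.eq_of_forall fun l _ => ?_
    by_cases hl : l = i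
    · subst hl
      rw [hc u, hc v, ← Finset.add_sum_erase _ _ (Finset.mem_univ l),
        ← Finset.add_sum_erase _ _ (Finset.mem_univ l),
        Finset.sum_congr rfl fun i hi => by rw [huv i hi]] at huj
      have := mul_left_cancel₀ hci (add_right_cancel huj)
      exact_mod_cast this
    · exact huv l (Finset.mem_erase.2 ⟨hl, Finset.mem_univ l⟩)
  refine ⟨A ^ (1 / 2 : ℝ) * ∑ i ∈ S, (1 + |c i|) * T ^ (Finset.univ.erase i).card, ?_, ?_⟩
  · refine mul_nonneg (Real.rpow_nonneg (by linarith) _) (Finset.sum_nonneg fun i _ => ?_)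
    have := abs_nonneg (c i)
    positivity
  intro N t
  have hAN : (A * (1 + N : ℝ)) ^ (1 / 2 : ℝ) = A ^ (1 / 2 : ℝ) * (1 + N : ℝ) ^ (1 / 2 : ℝ) :=
    Real.mul_rpow (by linarith) (by positivity)
  have hAN0 : 0 ≤ (A * (1 + N : ℝ)) ^ (1 / 2 : ℝ) :=
    Real.rpow_nonneg (mul_nonneg (by linarith) (by positivity)) _
  calc ∑ u ∈ cube r N with u j = t, ∏ i, (intWt (a i ⬝ᵥ u))⁻¹
      ≤ ∑ u ∈ cube r N with u j = t, (intWt t)⁻¹ * ∑ i ∈ S, (1 + |c i|) *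
          ((A * (1 + N)) ^ (1 / 2 : ℝ) *
            ∏ l ∈ Finset.univ.erase i, intWt (a l ⬝ᵥ u) ^ (-(1 + δ))) := by
        refine Finset.sum_le_sum fun u hu => (hprod u).trans ?_
        rw [(Finset.mem_filter.1 hu).2]
        refine mul_le_mul_of_nonneg_left (Finset.sum_le_sum fun i _ => ?_)
          (inv_nonneg.2 (intWt_pos _).le)
        exact mul_le_mul_of_nonneg_left (herase N u (Finset.mem_filter.1 hu).1 i)
          (by have := abs_nonneg (c i); linarith)
    _ = (intWt t)⁻¹ * ∑ i ∈ S, (1 + |c i|) * ((A * (1 + N)) ^ (1 / 2 : ℝ) *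
          ∑ u ∈ cube r N with u j = t,
            ∏ l ∈ Finset.univ.erase i, intWt (a l ⬝ᵥ u) ^ (-(1 + δ))) := by
        rw [← Finset.mul_sum, Finset.sum_comm]
        simp only [Finset.mul_sum]
    _ ≤ (intWt t)⁻¹ * ∑ i ∈ S, (1 + |c i|) * ((A * (1 + N)) ^ (1 / 2 : ℝ) *
          T ^ (Finset.univ.erase i).card) := by
        refine mul_le_mul_of_nonneg_left (Finset.sum_le_sum fun i hi => ?_)
          (inv_nonneg.2 (intWt_pos _).le)
        refine mul_le_mul_of_nonneg_left ?_ (by have := abs_nonneg (c i); linarith)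
        exact mul_le_mul_of_nonneg_left (hslice N t i hi) hAN0
    _ = _ := by
        rw [hAN, Finset.mul_sum, Finset.mul_sum, Finset.sum_mul, Finset.sum_mul]
        exact Finset.sum_congr rfl fun i _ => by ring

lemma sum_biUnion_le_of_nonneg {α κ : Type*} [DecidableEq α] {g : α → ℝ} (hg : ∀ x, 0 ≤ g x)
    (s : Finset κ) (t : κ → Finset α) : ∑ x ∈ s.biUnion t, g x ≤ ∑ i ∈ s, ∑ x ∈ t i, g x := by
  classical
  induction s using Finset.induction_on with
  | empty => simp
  | insert i s hi ih =>
    rw [Finset.biUnion_insert, Finset.sum_insert hi]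
    have := Finset.sum_union_inter (s₁ := t i) (s₂ := s.biUnion t) (f := g)
    have h2 : 0 ≤ ∑ x ∈ t i ∩ s.biUnion t, g x := Finset.sum_nonneg fun x _ => hg x
    linarith

/-- The lattice points within distance `K` of the boundary of the cube. -/
noncomputable def shell (r N K : ℕ) : Finset (Fin r → ℤ) :=
  (cube r (N + K)).filter fun u => ∃ j, (N : ℤ) - K ≤ |u j|

lemma tendsto_sum_shell [DecidableEq ι] {a : ι → Fin r → ℤ} (hι : Nonempty ι) (hsp : SpansCoords a Finset.univ)
    (K : ℕ) :
    Tendsto (fun N => ∑ u ∈ shell r N K, ∏ i, (intWt (a i ⬝ᵥ u))⁻¹) atTop (𝓝 0) := by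
  choose C hC0 hC using fun j => exists_slice_le hι hsp j
  let V : ℕ → Finset ℤ := fun N =>
    Finset.Icc (-((N : ℤ) + K)) (-((N : ℤ) - K)) ∪ Finset.Icc ((N : ℤ) - K) ((N : ℤ) + K)
  have hVcard : ∀ N, ((V N).card : ℝ) ≤ 2 * (2 * K + 1) := by
    intro N
    have : (V N).card ≤ 2 * (2 * K + 1) := by
      refine (Finset.card_union_le _ _).trans ?_
      simp only [Int.card_Icc]
      omega
    exact_mod_cast this
  have hnn : ∀ u : Fin r → ℤ, 0 ≤ ∏ i, (intWt (a i ⬝ᵥ u))⁻¹ := fun u =>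
    Finset.prod_nonneg fun i _ => inv_nonneg.2 (intWt_pos _).le
  have hbound : ∀ N : ℕ, K ≤ N → ∑ u ∈ shell r N K, ∏ i, (intWt (a i ⬝ᵥ u))⁻¹ ≤
      (∑ j, 2 * (2 * K + 1) * C j) * ((1 + (N + K : ℕ) : ℝ) ^ (1 / 2 : ℝ) * (1 + N - K : ℝ)⁻¹) := by
    intro N hKN
    have hKN' : (K : ℝ) ≤ N := by exact_mod_cast hKN
    have hsub : shell r N K ⊆ Finset.univ.biUnion fun j => (V N).biUnion fun t =>
        (cube r (N + K)).filter fun u => u j = t := by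
      intro u hu
      obtain ⟨hu1, j, hj⟩ := Finset.mem_filter.1 hu
      simp only [Finset.mem_biUnion, Finset.mem_univ, true_and, Finset.mem_filter]
      refine ⟨j, u j, ?_, hu1, rfl⟩
      have h2 := mem_cube.1 hu1 j
      push_cast at h2
      simp only [V, Finset.mem_union, Finset.mem_Icc]
      rcases abs_cases (u j) with h | h <;> omega
    calc ∑ u ∈ shell r N K, ∏ i, (intWt (a i ⬝ᵥ u))⁻¹
        ≤ ∑ j, ∑ t ∈ V N, ∑ u ∈ cube r (N + K) with u j = t, ∏ i, (intWt (a i ⬝ᵥ u))⁻¹ := by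
          refine (Finset.sum_le_sum_of_subset_of_nonneg hsub fun u _ _ => hnn u).trans ?_
          refine (sum_biUnion_le_of_nonneg hnn _ _).trans (Finset.sum_le_sum fun j _ => ?_)
          exact sum_biUnion_le_of_nonneg hnn _ _
      _ ≤ ∑ j, ∑ t ∈ V N, C j * (1 + (N + K : ℕ) : ℝ) ^ (1 / 2 : ℝ) * (1 + N - K : ℝ)⁻¹ := by
          refine Finset.sum_le_sum fun j _ => Finset.sum_le_sum fun t ht => (hC j _ t).trans ?_
          refine mul_le_mul_of_nonneg_left ?_ (mul_nonneg (hC0 j) (by positivity))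
          refine inv_anti₀ (by linarith) ?_
          have h1 : (N : ℤ) - K ≤ |t| := by
            simp only [V, Finset.mem_union, Finset.mem_Icc] at ht
            rcases abs_cases t with h | h <;> omega
          have h2 : (N : ℝ) - K ≤ |(t : ℝ)| := by exact_mod_cast h1
          unfold intWt
          linarith
      _ = ∑ j, (V N).card * (C j * (1 + (N + K : ℕ) : ℝ) ^ (1 / 2 : ℝ) * (1 + N - K : ℝ)⁻¹) := by
          simp only [Finset.sum_const, nsmul_eq_mul]
      _ ≤ ∑ j, 2 * (2 * K + 1) *
            (C j * (1 + (N + K : ℕ) : ℝ) ^ (1 / 2 : ℝ) * (1 + N - K : ℝ)⁻¹) := by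
          refine Finset.sum_le_sum fun j _ => mul_le_mul_of_nonneg_right (hVcard N) ?_
          have : 0 ≤ (1 + N - K : ℝ)⁻¹ := inv_nonneg.2 (by linarith)
          have := hC0 j
          positivity
      _ = _ := by
          rw [Finset.sum_mul]
          exact Finset.sum_congr rfl fun j _ => by ring
  have hlim : Tendsto (fun N : ℕ => (1 + (N + K : ℕ) : ℝ) ^ (1 / 2 : ℝ) * (1 + N - K : ℝ)⁻¹)
      atTop (𝓝 0) := by
    have h1 : Tendsto (fun N : ℕ => ((1 + (N + K : ℕ) : ℝ)) ^ (-(1 / 2 : ℝ))) atTop (𝓝 0) := by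
      refine (tendsto_rpow_neg_atTop (by norm_num)).comp (tendsto_atTop_mono (fun N => ?_)
        (tendsto_natCast_atTop_atTop (R := ℝ)))
      push_cast
      have : (0 : ℝ) ≤ K := Nat.cast_nonneg K
      linarith
    have h3 := h1.const_mul 3
    rw [mul_zero] at h3
    refine squeeze_zero' ?_ ?_ h3
    · filter_upwards [eventually_ge_atTop K] with N hN
      have hN' : (K : ℝ) ≤ N := by exact_mod_cast hN
      have : 0 ≤ (1 + N - K : ℝ)⁻¹ := inv_nonneg.2 (by linarith)
      positivity
    · filter_upwards [eventually_ge_atTop (2 * K)] with N hN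
      have hN' : 2 * (K : ℝ) ≤ N := by exact_mod_cast hN
      have hK : (0 : ℝ) ≤ K := Nat.cast_nonneg K
      have hX : (0 : ℝ) < 1 + (N + K : ℕ) := by positivity
      have hinv : (1 + N - K : ℝ)⁻¹ ≤ 3 * (1 + (N + K : ℕ) : ℝ)⁻¹ := by
        rw [← div_eq_mul_inv, inv_eq_one_div, div_le_div_iff₀ (by linarith) hX]
        push_cast
        linarith
      refine (mul_le_mul_of_nonneg_left hinv (Real.rpow_nonneg hX.le _)).trans (le_of_eq ?_)
      rw [mul_left_comm, ← Real.rpow_neg_one (1 + (N + K : ℕ) : ℝ), ← Real.rpow_add hX]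
      norm_num
  have h0 := hlim.const_mul (∑ j, 2 * (2 * K + 1) * C j)
  rw [mul_zero] at h0
  exact squeeze_zero' (Eventually.of_forall fun N => Finset.sum_nonneg fun u _ => hnn u)
    ((eventually_ge_atTop K).mono hbound) h0

end

section

variable {r : ℕ}

lemma intVec_add (u v : Fin r → ℤ) : intVec (u + v) = intVec u + intVec v := by
  ext j; simp [intVec]

lemma inner_intVec (u v : Fin r → ℤ) : inner ℝ (intVec u) (intVec v) = ((u ⬝ᵥ v : ℤ) : ℝ) := by
  simp [intVec, EuclideanSpace.inner_eq_star_dotProduct, dotProduct, mul_comm]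

/-- The phase `exp(2πi⟨y, v⟩)`. -/
noncomputable def phase (y : EuclideanSpace ℝ (Fin r)) (v : Fin r → ℤ) : ℂ :=
  Complex.exp (2 * Real.pi * Complex.I * ((inner ℝ y (intVec v) : ℝ) : ℂ))

lemma phase_add (y : EuclideanSpace ℝ (Fin r)) (u v : Fin r → ℤ) :
    phase y (u + v) = phase y u * phase y v := by
  rw [phase, phase, phase, ← Complex.exp_add, intVec_add, inner_add_right]
  congr 1; push_cast; ring

lemma norm_phase (y : EuclideanSpace ℝ (Fin r)) (v : Fin r → ℤ) : ‖phase y v‖ = 1 := by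
  rw [phase, show (2 * Real.pi * Complex.I * ((inner ℝ y (intVec v) : ℝ) : ℂ) : ℂ) =
    ((2 * Real.pi * inner ℝ y (intVec v) : ℝ) : ℂ) * Complex.I by push_cast; ring]
  exact Complex.norm_exp_ofReal_mul_I _

lemma continuous_phase (v : Fin r → ℤ) :
    Continuous fun y : EuclideanSpace ℝ (Fin r) => phase y v := by
  unfold phase
  fun_prop

lemma phase_eq_one_iff {y : EuclideanSpace ℝ (Fin r)} {v : Fin r → ℤ} :
    phase y v = 1 ↔ ∃ n : ℤ, inner ℝ y (intVec v) = (n : ℝ) := by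
  rw [phase, Complex.exp_eq_one_iff]
  refine exists_congr fun n => ?_
  rw [mul_comm, mul_left_inj' Complex.two_pi_I_ne_zero]
  exact_mod_cast Iff.rfl

variable {ι : Type*} [Fintype ι]

/-- The sum over the cube of side `N` of a phase times a product of functions of
the values `⟨a i, v⟩`. -/
noncomputable def cubeSum (a : ι → Fin r → ℤ) (φ : ι → ℤ → ℂ) (y : EuclideanSpace ℝ (Fin r))
    (N : ℕ) : ℂ :=
  ∑ v ∈ cube r N, phase y v * ∏ i, φ i (a i ⬝ᵥ v)

/-- Shifting by a vector orthogonal to all functionals but one replaces that factor by its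
difference, up to a boundary term. -/
lemma tendsto_cubeSum_sub_difference [DecidableEq ι] {a : ι → Fin r → ℤ} (hι : Nonempty ι)
    (hsp : SpansCoords a Finset.univ) {φ : ι → ℤ → ℂ} {C : ι → ℝ}
    (hφ : ∀ i n, ‖φ i n‖ ≤ C i * (intWt n)⁻¹) {d : ι} {w : Fin r → ℤ}
    (hw : ∀ i ≠ d, a i ⬝ᵥ w = 0) (y : EuclideanSpace ℝ (Fin r)) :
    Tendsto (fun N => (1 - phase y w) * cubeSum a φ y N -
      cubeSum a (Function.update φ d fun n => φ d n - φ d (n - a d ⬝ᵥ w)) y N) atTop (𝓝 0) := by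
  set K : ℕ := ∑ j, (w j).natAbs with hK
  have hwK : ∀ j, |w j| ≤ K := by
    intro j
    rw [Int.abs_eq_natAbs]
    exact_mod_cast Finset.single_le_sum (f := fun j => (w j).natAbs) (fun _ _ => Nat.zero_le _)
      (Finset.mem_univ j)
  set G : (Fin r → ℤ) → ℂ := fun v => ∏ i, φ i (a i ⬝ᵥ v) with hG
  have hdiff : ∀ v, ∏ i, (Function.update φ d fun n => φ d n - φ d (n - a d ⬝ᵥ w)) i (a i ⬝ᵥ v) =
      G v - G (v - w) := by
    intro v
    simp only [hG]
    rw [← Finset.mul_prod_erase _ _ (Finset.mem_univ d),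
      ← Finset.mul_prod_erase _ _ (Finset.mem_univ d),
      ← Finset.mul_prod_erase _ _ (Finset.mem_univ d)]
    have h1 : ∏ i ∈ Finset.univ.erase d, φ i (a i ⬝ᵥ (v - w)) =
        ∏ i ∈ Finset.univ.erase d, φ i (a i ⬝ᵥ v) := by
      refine Finset.prod_congr rfl fun i hi => ?_
      rw [dotProduct_sub, hw i (Finset.ne_of_mem_erase hi), sub_zero]
    have h2 : ∏ i ∈ Finset.univ.erase d,
        (Function.update φ d fun n => φ d n - φ d (n - a d ⬝ᵥ w)) i (a i ⬝ᵥ v) =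
        ∏ i ∈ Finset.univ.erase d, φ i (a i ⬝ᵥ v) := by
      refine Finset.prod_congr rfl fun i hi => ?_
      rw [Function.update_of_ne (Finset.ne_of_mem_erase hi)]
    rw [h1, h2, Function.update_self, dotProduct_sub]
    ring
  set h : (Fin r → ℤ) → ℂ := fun u => phase y (u + w) * G u with hh
  have hnorm : ∀ u, ‖h u‖ ≤ (∏ i, C i) * ∏ i, (intWt (a i ⬝ᵥ u))⁻¹ := by
    intro u
    rw [hh, norm_mul, norm_phase, one_mul, hG, norm_prod, ← Finset.prod_mul_distrib]
    exact Finset.prod_le_prod (fun i _ => norm_nonneg _) fun i _ => hφ i _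
  have hid : ∀ N, (1 - phase y w) * cubeSum a φ y N -
      cubeSum a (Function.update φ d fun n => φ d n - φ d (n - a d ⬝ᵥ w)) y N =
      ∑ u ∈ (cube r N).image (fun v => v - w) \ cube r N, h u -
        ∑ u ∈ cube r N \ (cube r N).image (fun v => v - w), h u := by
    intro N
    rw [Finset.sum_sdiff_sub_sum_sdiff, Finset.sum_image fun _ _ _ _ huv => sub_left_inj.1 huv]
    simp only [cubeSum, hdiff]
    rw [Finset.mul_sum, ← Finset.sum_sub_distrib, ← Finset.sum_sub_distrib]
    refine Finset.sum_congr rfl fun v _ => ?_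
    simp only [hh, hG, sub_add_cancel]
    rw [phase_add y v w]
    ring
  have hS1 : ∀ N, (cube r N).image (fun v => v - w) \ cube r N ⊆ shell r N K := by
    intro N u hu
    obtain ⟨hu1, hu2⟩ := Finset.mem_sdiff.1 hu
    obtain ⟨v, hv, rfl⟩ := Finset.mem_image.1 hu1
    rw [mem_cube] at hu2
    push Not at hu2
    obtain ⟨j, hj⟩ := hu2
    refine Finset.mem_filter.2 ⟨mem_cube.2 fun l => ?_, j, by omega⟩
    have h1 := mem_cube.1 hv l
    have h2 := hwK l
    have h3 := abs_sub (v l) (w l)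
    rw [Pi.sub_apply]
    push_cast
    linarith
  have hS2 : ∀ N, cube r N \ (cube r N).image (fun v => v - w) ⊆ shell r N K := by
    intro N u hu
    obtain ⟨hu1, hu2⟩ := Finset.mem_sdiff.1 hu
    have hu3 : u + w ∉ cube r N := fun hmem =>
      hu2 (Finset.mem_image.2 ⟨u + w, hmem, add_sub_cancel_right u w⟩)
    rw [mem_cube] at hu1 hu3
    push Not at hu3
    obtain ⟨j, hj⟩ := hu3
    refine Finset.mem_filter.2 ⟨mem_cube.2 fun l => ?_, j, ?_⟩
    · have := hu1 l
      push_cast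
      omega
    · have h2 := hwK j
      have h3 := abs_add_le (u j) (w j)
      rw [Pi.add_apply] at hj
      linarith
  have hbound : ∀ N, ‖(1 - phase y w) * cubeSum a φ y N -
      cubeSum a (Function.update φ d fun n => φ d n - φ d (n - a d ⬝ᵥ w)) y N‖ ≤
      2 * (∏ i, C i) * ∑ u ∈ shell r N K, ∏ i, (intWt (a i ⬝ᵥ u))⁻¹ := by
    intro N
    have hone : ∀ S ⊆ shell r N K, ‖∑ u ∈ S, h u‖ ≤
        (∏ i, C i) * ∑ u ∈ shell r N K, ∏ i, (intWt (a i ⬝ᵥ u))⁻¹ := by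
      intro S hS
      rw [Finset.mul_sum]
      refine (norm_sum_le _ _).trans ?_
      refine (Finset.sum_le_sum_of_subset_of_nonneg hS fun u _ _ => norm_nonneg _).trans ?_
      exact Finset.sum_le_sum fun u _ => hnorm u
    rw [hid N]
    refine (norm_sub_le _ _).trans ((add_le_add (hone _ (hS1 N)) (hone _ (hS2 N))).trans ?_)
    exact le_of_eq (by ring)
  have h0 := (tendsto_sum_shell hι hsp K).const_mul (2 * ∏ i, C i)
  rw [mul_zero] at h0
  exact squeeze_zero_norm hbound h0

/-- Difference the factors indexed by `D` along the vectors `w`. -/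
def differenced [DecidableEq ι] (a : ι → Fin r → ℤ) (φ : ι → ℤ → ℂ) (w : ι → Fin r → ℤ)
    (D : Finset ι) (i : ι) (n : ℤ) : ℂ :=
  if i ∈ D then φ i n - φ i (n - a i ⬝ᵥ w i) else φ i n

lemma tendsto_cubeSum_sub_differenced [DecidableEq ι] {a : ι → Fin r → ℤ} (hι : Nonempty ι)
    (hsp : SpansCoords a Finset.univ) {φ : ι → ℤ → ℂ} {w : ι → Fin r → ℤ} (D : Finset ι)
    (hφ : ∀ D' ⊆ D, ∀ i, ∃ C : ℝ, ∀ n, ‖differenced a φ w D' i n‖ ≤ C * (intWt n)⁻¹)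
    (hw : ∀ d ∈ D, ∀ i ≠ d, a i ⬝ᵥ w d = 0) (y : EuclideanSpace ℝ (Fin r)) :
    Tendsto (fun N => (∏ d ∈ D, (1 - phase y (w d))) * cubeSum a φ y N -
      cubeSum a (differenced a φ w D) y N) atTop (𝓝 0) := by
  induction D using Finset.induction_on with
  | empty =>
    have : differenced a φ w ∅ = φ := by
      funext i n; simp [differenced]
    simp [this]
  | insert d D hd ih =>
    have ih' := ih (fun D' hD' => hφ D' (hD'.trans (Finset.subset_insert d D)))
      fun d' hd' => hw d' (Finset.mem_insert_of_mem hd')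
    choose C hC using hφ D (Finset.subset_insert d D)
    have hstep := tendsto_cubeSum_sub_difference hι hsp hC
      (hw d (Finset.mem_insert_self d D)) y
    have hupd : (Function.update (differenced a φ w D) d fun n =>
        differenced a φ w D d n - differenced a φ w D d (n - a d ⬝ᵥ w d)) =
        differenced a φ w (insert d D) := by
      funext i n
      by_cases hi : i = d
      · subst hi
        simp [differenced, hd]
      · simp [differenced, hi]
    rw [hupd] at hstep
    have := (ih'.const_mul (1 - phase y (w d))).add hstep
    rw [mul_zero, zero_add] at this
    refine this.congr fun N => ?_
    rw [Finset.prod_insert hd]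
    ring

/-- The cube sums converge, locally uniformly in the phase, after multiplication by the
differencing factors. -/
lemma exists_continuous_tendsto_mul_cubeSum [DecidableEq ι] {a : ι → Fin r → ℤ} (hι : Nonempty ι)
    (hsp : SpansCoords a Finset.univ) {φ : ι → ℤ → ℂ} {w : ι → Fin r → ℤ} {D : Finset ι}
    {e : ι → ℕ} (he : ∀ i, e i = 1 ∨ e i = 2)
    (hφ : ∀ i, ∃ C : ℝ, ∀ n, ‖φ i n‖ ≤ C * (intWt n)⁻¹ ^ e i)
    (hD : ∀ d ∈ D, ∃ C : ℝ, ∀ n, ‖φ d n - φ d (n - a d ⬝ᵥ w d)‖ ≤ C * (intWt n)⁻¹ ^ 2)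
    (hw : ∀ d ∈ D, ∀ i ≠ d, a i ⬝ᵥ w d = 0)
    (hnD : ∀ i ∉ D, SpansCoords a (Finset.univ.erase i) ∨ e i = 2) :
    ∃ T : EuclideanSpace ℝ (Fin r) → ℂ, Continuous T ∧
      ∀ y, Tendsto (fun N => (∏ d ∈ D, (1 - phase y (w d))) * cubeSum a φ y N) atTop
        (𝓝 (T y)) := by
  have hweak : ∀ (C : ℝ) (k : ℕ) (n : ℤ) (z : ℂ), k ≠ 0 → ‖z‖ ≤ C * (intWt n)⁻¹ ^ k →
      ‖z‖ ≤ C * (intWt n)⁻¹ := by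
    intro C k n z hk hz
    have hpos : 0 < (intWt n)⁻¹ := inv_pos.2 (intWt_pos n)
    have hC : 0 ≤ C := by
      by_contra hC
      have := mul_neg_of_neg_of_pos (not_le.1 hC) (pow_pos hpos k)
      linarith [norm_nonneg z]
    exact hz.trans (mul_le_mul_of_nonneg_left
      (pow_le_of_le_one hpos.le (inv_le_one_of_one_le₀ (one_le_intWt n)) hk) hC)
  have hstep := tendsto_cubeSum_sub_differenced hι hsp (φ := φ) (w := w) D (fun D' hD' i => by
    by_cases hi : i ∈ D'
    · obtain ⟨C, hC⟩ := hD i (hD' hi)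
      exact ⟨C, fun n => hweak C 2 n _ two_ne_zero (by simpa [differenced, hi] using hC n)⟩
    · obtain ⟨C, hC⟩ := hφ i
      refine ⟨C, fun n => hweak C (e i) n _ ?_ (by simpa [differenced, hi] using hC n)⟩
      rcases he i with h | h <;> omega) hw
  let e' : ι → ℕ := fun i => if i ∈ D then 2 else e i
  have hbd : ∀ i, ∃ C : ℝ, ∀ n, ‖differenced a φ w D i n‖ ≤ C * (intWt n)⁻¹ ^ e' i := by
    intro i
    by_cases hi : i ∈ D
    · simpa [differenced, hi, e'] using hD i hi
    · simpa [differenced, hi, e'] using hφ i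
  choose C hC using hbd
  have hsum : Summable fun v : Fin r → ℤ => (∏ i, C i) * ∏ i, (intWt (a i ⬝ᵥ v))⁻¹ ^ e' i := by
    refine (summable_prod_intWt hι hsp (fun i => ?_) fun i => ?_).mul_left _
    · simp only [e']
      split_ifs
      · norm_num
      · rcases he i with h | h <;> omega
    · by_cases hi : i ∈ D
      · simp [e', hi]
      · exact (hnD i hi).imp_right fun h => by simp [e', hi, h]
  have hle : ∀ (v : Fin r → ℤ) (y : EuclideanSpace ℝ (Fin r)),
      ‖phase y v * ∏ i, differenced a φ w D i (a i ⬝ᵥ v)‖ ≤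
        (∏ i, C i) * ∏ i, (intWt (a i ⬝ᵥ v))⁻¹ ^ e' i := by
    intro v y
    rw [norm_mul, norm_phase, one_mul, norm_prod, ← Finset.prod_mul_distrib]
    exact Finset.prod_le_prod (fun i _ => norm_nonneg _) fun i _ => hC i _
  refine ⟨fun y => ∑' v : Fin r → ℤ, phase y v * ∏ i, differenced a φ w D i (a i ⬝ᵥ v),
    continuous_tsum (fun v => (continuous_phase v).mul continuous_const) hsum hle, fun y => ?_⟩
  have hcube : Tendsto (cube r) atTop atTop := by
    refine tendsto_atTop_finset_of_monotone (fun M N hMN u hu => ?_) fun u => ?_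
    · refine mem_cube.2 fun j => (mem_cube.1 hu j).trans ?_
      exact_mod_cast hMN
    · refine ⟨∑ j, (u j).natAbs, mem_cube.2 fun j => ?_⟩
      rw [Int.abs_eq_natAbs]
      exact_mod_cast Finset.single_le_sum (f := fun j => (u j).natAbs)
        (fun _ _ => Nat.zero_le _) (Finset.mem_univ j)
  have hT := (Summable.of_norm_bounded hsum fun v => hle v y).hasSum.comp hcube
  have := (hstep y).add hT
  rw [zero_add] at this
  refine this.congr fun N => ?_
  simp [cubeSum]

end

lemma exists_intWt_le_mul_norm (c : ℂ) :
    ∃ K : ℝ, 0 < K ∧ ∀ n : ℤ, (n : ℂ) + c ≠ 0 → intWt n ≤ K * ‖(n : ℂ) + c‖ := by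
  set M : ℤ := ⌈‖c‖ + 1⌉
  obtain ⟨B, hB⟩ := ((Finset.Icc (-M) M).image fun n : ℤ => ‖(n : ℂ) + c‖⁻¹).bddAbove
  set L : ℝ := max B 1
  have hlow : ∀ n : ℤ, (n : ℂ) + c ≠ 0 → 1 ≤ L * ‖(n : ℂ) + c‖ := by
    intro n hn
    have hpos : 0 < ‖(n : ℂ) + c‖ := norm_pos_iff.2 hn
    by_cases hnM : n ∈ Finset.Icc (-M) M
    · have h1 : ‖(n : ℂ) + c‖⁻¹ ≤ L :=
        (hB (Finset.mem_coe.2 (Finset.mem_image_of_mem _ hnM))).trans (le_max_left _ _)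
      rw [← inv_mul_cancel₀ hpos.ne']
      exact mul_le_mul_of_nonneg_right h1 hpos.le
    · have h1 : M < |n| := by
        rw [Finset.mem_Icc, ← abs_le] at hnM
        exact not_le.1 hnM
      have h2 : (M : ℝ) < |(n : ℝ)| := by exact_mod_cast h1
      have h3 : ‖c‖ + 1 ≤ M := Int.le_ceil _
      have h4 : |(n : ℝ)| ≤ ‖(n : ℂ) + c‖ + ‖c‖ := by
        have := norm_sub_le ((n : ℂ) + c) c
        rwa [add_sub_cancel_right, Complex.norm_intCast] at this
      have h5 : 1 ≤ L := le_max_right _ _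
      nlinarith
  refine ⟨1 + (1 + ‖c‖) * L, ?_, fun n hn => ?_⟩
  · have : 1 ≤ L := le_max_right _ _
    positivity
  · have h4 : |(n : ℝ)| ≤ ‖(n : ℂ) + c‖ + ‖c‖ := by
      have := norm_sub_le ((n : ℂ) + c) c
      rwa [add_sub_cancel_right, Complex.norm_intCast] at this
    have h5 := mul_le_mul_of_nonneg_left (hlow n hn) (by positivity : 0 ≤ 1 + ‖c‖)
    unfold intWt
    nlinarith

/-- The factor of the lattice sum attached to the constant `c` and the exponent `k`, as a
function of the value `n` of the linear part. -/
noncomputable def latticeFactor (c : ℂ) (k : ℕ) (n : ℤ) : ℂ :=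
  if k = 0 then (if (n : ℂ) + c = 0 then 1 else 0)
  else if (n : ℂ) + c = 0 then 0 else 1 / ((n : ℂ) + c) ^ k

lemma intWt_le_of_add_eq_zero {c : ℂ} {n : ℤ} (h : (n : ℂ) + c = 0) : intWt n ≤ 1 + ‖c‖ := by
  have : ‖(n : ℂ)‖ = ‖c‖ := by rw [eq_neg_of_add_eq_zero_left h, norm_neg]
  rw [Complex.norm_intCast] at this
  unfold intWt
  linarith

lemma intWt_le_mul_intWt_sub (n m : ℤ) : intWt n ≤ intWt m * intWt (n - m) := by
  have h : |(n : ℝ)| ≤ |(m : ℝ)| + |((n - m : ℤ) : ℝ)| := by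
    have := abs_add_le (m : ℝ) ((n - m : ℤ) : ℝ)
    push_cast at this ⊢
    simpa using this
  unfold intWt
  nlinarith [abs_nonneg (m : ℝ), abs_nonneg ((n - m : ℤ) : ℝ)]

lemma norm_le_of_mul_sq_le {z : ℂ} {C : ℝ} {n : ℤ} (h : ‖z‖ * intWt n ^ 2 ≤ C) :
    ‖z‖ ≤ C * (intWt n)⁻¹ ^ 2 := by
  rw [inv_pow, ← div_eq_mul_inv, le_div_iff₀ (pow_pos (intWt_pos n) 2)]
  exact h

lemma exists_norm_latticeFactor_one_le (c : ℂ) :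
    ∃ C : ℝ, 0 < C ∧ ∀ n, ‖latticeFactor c 1 n‖ * intWt n ≤ C := by
  obtain ⟨K, hK, hb⟩ := exists_intWt_le_mul_norm c
  refine ⟨K, hK, fun n => ?_⟩
  by_cases hn : (n : ℂ) + c = 0
  · simp [latticeFactor, hn, hK.le]
  · have hpos : 0 < ‖(n : ℂ) + c‖ := norm_pos_iff.2 hn
    simp only [latticeFactor, one_ne_zero, hn, if_false, pow_one, norm_div, norm_one]
    rw [one_div_mul_eq_div, div_le_iff₀ hpos]
    exact hb n hn

lemma exists_norm_latticeFactor_le (c : ℂ) (k : ℕ) :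
    ∃ C : ℝ, ∀ n, ‖latticeFactor c k n‖ ≤ C * (intWt n)⁻¹ ^ (if k = 1 then 1 else 2) := by
  obtain ⟨K, hK, hb⟩ := exists_intWt_le_mul_norm c
  rcases Nat.lt_or_ge k 2 with hk | hk
  · interval_cases k
    · refine ⟨(1 + ‖c‖) ^ 2, fun n => norm_le_of_mul_sq_le ?_⟩
      by_cases hn : (n : ℂ) + c = 0
      · simp only [latticeFactor, hn, if_true, norm_one, one_mul]
        exact pow_le_pow_left₀ (intWt_pos n).le (intWt_le_of_add_eq_zero hn) 2
      · simp only [latticeFactor, hn, if_true, if_false, norm_zero, zero_mul]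
        positivity
    · obtain ⟨C, -, hC⟩ := exists_norm_latticeFactor_one_le c
      refine ⟨C, fun n => ?_⟩
      rw [if_pos rfl, pow_one, ← div_eq_mul_inv, le_div_iff₀ (intWt_pos n)]
      exact hC n
  · refine ⟨K ^ k, fun n => ?_⟩
    rw [if_neg (by omega)]
    refine norm_le_of_mul_sq_le ?_
    by_cases hn : (n : ℂ) + c = 0
    · simp only [latticeFactor, hn, if_true, show k ≠ 0 by omega, if_false, norm_zero, zero_mul]
      positivity
    · have hpos : 0 < ‖(n : ℂ) + c‖ := norm_pos_iff.2 hn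
      simp only [latticeFactor, hn, show k ≠ 0 by omega, if_false, norm_div, norm_one, norm_pow]
      rw [one_div_mul_eq_div, div_le_iff₀ (pow_pos hpos k), ← mul_pow]
      exact (pow_le_pow_right₀ (one_le_intWt n) hk).trans
        (pow_le_pow_left₀ (intWt_pos n).le (hb n hn) k)

lemma exists_norm_latticeFactor_sub_le (c : ℂ) (m : ℤ) :
    ∃ C : ℝ, ∀ n, ‖latticeFactor c 1 n - latticeFactor c 1 (n - m)‖ ≤ C * (intWt n)⁻¹ ^ 2 := by
  obtain ⟨K, hK, hb⟩ := exists_norm_latticeFactor_one_le c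
  have hone : ∀ n, ‖latticeFactor c 1 n‖ ≤ K := fun n => by
    refine le_trans ?_ (hb n)
    exact le_mul_of_one_le_right (norm_nonneg _) (one_le_intWt n)
  have hdeg : ∀ n : ℤ, ((n : ℂ) + c = 0 ∨ ((n - m : ℤ) : ℂ) + c = 0) →
      intWt n ≤ intWt m * (1 + ‖c‖) := by
    rintro n (h | h)
    · refine (intWt_le_of_add_eq_zero h).trans ?_
      exact le_mul_of_one_le_left (by positivity) (one_le_intWt m)
    · exact (intWt_le_mul_intWt_sub n m).trans
        (mul_le_mul_of_nonneg_left (intWt_le_of_add_eq_zero h) (intWt_pos m).le)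
  refine ⟨2 * K * (intWt m * (1 + ‖c‖)) ^ 2 + ‖(m : ℂ)‖ * K ^ 2 * intWt m,
    fun n => norm_le_of_mul_sq_le ?_⟩
  have hm := intWt_pos m
  have hn := intWt_pos n
  by_cases h : (n : ℂ) + c = 0 ∨ ((n - m : ℤ) : ℂ) + c = 0
  · have h1 : ‖latticeFactor c 1 n - latticeFactor c 1 (n - m)‖ ≤ 2 * K := by
      have := norm_sub_le (latticeFactor c 1 n) (latticeFactor c 1 (n - m))
      linarith [hone n, hone (n - m)]
    have h2 : intWt n ^ 2 ≤ (intWt m * (1 + ‖c‖)) ^ 2 := pow_le_pow_left₀ hn.le (hdeg n h) 2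
    have h3 := mul_le_mul h1 h2 (by positivity) (by positivity)
    have : 0 ≤ ‖(m : ℂ)‖ * K ^ 2 * intWt m := by positivity
    linarith
  · push Not at h
    have hid : latticeFactor c 1 n - latticeFactor c 1 (n - m) =
        -m * (latticeFactor c 1 n * latticeFactor c 1 (n - m)) := by
      simp only [latticeFactor, one_ne_zero, h.1, h.2, if_false, pow_one]
      have h1 := h.1
      have h2 := h.2
      rw [div_sub_div _ _ h1 h2, div_mul_div_comm, mul_div_assoc']
      push_cast
      congr 1
      ring
    have h1 : ‖latticeFactor c 1 n * latticeFactor c 1 (n - m)‖ * intWt n ^ 2 ≤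
        K ^ 2 * intWt m := by
      rw [norm_mul]
      calc ‖latticeFactor c 1 n‖ * ‖latticeFactor c 1 (n - m)‖ * intWt n ^ 2
          = (‖latticeFactor c 1 n‖ * intWt n) * (‖latticeFactor c 1 (n - m)‖ * intWt n) := by ring
        _ ≤ K * (‖latticeFactor c 1 (n - m)‖ * (intWt m * intWt (n - m))) := by
          refine mul_le_mul (hb n) ?_ (by positivity) hK.le
          exact mul_le_mul_of_nonneg_left (intWt_le_mul_intWt_sub n m) (norm_nonneg _)
        _ = K * intWt m * (‖latticeFactor c 1 (n - m)‖ * intWt (n - m)) := by ring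
        _ ≤ K * intWt m * K := mul_le_mul_of_nonneg_left (hb _) (by positivity)
        _ = _ := by ring
    rw [hid, norm_mul, norm_neg, mul_assoc]
    have h2 := mul_le_mul_of_nonneg_left h1 (norm_nonneg (m : ℂ))
    have : 0 ≤ 2 * K * (intWt m * (1 + ‖c‖)) ^ 2 := by positivity
    linarith

section

variable {r : ℕ}

/-- Integer vectors in the rational space. -/
def ratVec (v : Fin r → ℤ) : Fin r → ℚ := fun j => v j

lemma exists_intVec_orthogonal {S : Set (Fin r → ℤ)}
    (hS : Submodule.span ℚ (ratVec '' S) ≠ ⊤) :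
    ∃ w : Fin r → ℤ, w ≠ 0 ∧ ∀ v ∈ S, v ⬝ᵥ w = 0 := by
  obtain ⟨f, hf, hker⟩ := Submodule.exists_le_ker_of_lt_top _ hS.lt_top
  obtain ⟨b, hb⟩ := IsLocalization.exist_integer_multiples_of_finite (nonZeroDivisors ℤ)
    fun j : Fin r => f (Pi.single j 1)
  choose w hw using hb
  have hb0 : ((b : ℤ) : ℚ) ≠ 0 := by exact_mod_cast nonZeroDivisors.coe_ne_zero b
  have hw' : ∀ j, (w j : ℚ) = b * f (Pi.single j 1) := fun j => by
    have := hw j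
    simpa [Algebra.smul_def] using this
  have hval : ∀ x : Fin r → ℚ, f x = ∑ j, x j * f (Pi.single j 1) := by
    intro x
    conv_lhs => rw [pi_eq_sum_univ' x]
    simp [map_sum, map_smul]
  refine ⟨w, ?_, fun v hv => ?_⟩
  · rintro rfl
    refine hf (LinearMap.ext fun x => ?_)
    rw [hval, LinearMap.zero_apply]
    refine Finset.sum_eq_zero fun j _ => ?_
    have h1 := hw' j
    simp only [Pi.zero_apply, Int.cast_zero] at h1
    rw [(mul_eq_zero.1 h1.symm).resolve_left hb0, mul_zero]
  · have h0 : f (ratVec v) = 0 := hker (Submodule.subset_span ⟨v, hv, rfl⟩)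
    have h1 : ((v ⬝ᵥ w : ℤ) : ℚ) = b * f (ratVec v) := by
      rw [hval, dotProduct, Finset.mul_sum]
      push_cast
      refine Finset.sum_congr rfl fun j _ => ?_
      rw [hw' j, ratVec]
      ring
    rw [h0, mul_zero] at h1
    exact_mod_cast h1

lemma finrank_span_lt_of_orthogonal {S : Set (Fin r → ℤ)} {w : Fin r → ℤ} (hw : w ≠ 0)
    (h : ∀ v ∈ S, v ⬝ᵥ w = 0) : Module.finrank ℤ (Submodule.span ℤ S) < r := by
  obtain ⟨j, hj⟩ : ∃ j, w j ≠ 0 := by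
    by_contra hne
    push Not at hne
    exact hw (funext hne)
  set g : (Fin r → ℤ) →ₗ[ℤ] ℤ :=
    { toFun := fun v => v ⬝ᵥ w
      map_add' := fun u v => add_dotProduct u v w
      map_smul' := fun c v => smul_dotProduct c v w } with hg
  have hle : Submodule.span ℤ S ≤ LinearMap.ker g := Submodule.span_le.2 fun v hv => h v hv
  have h1 : Module.finrank ℤ (Submodule.span ℤ S) ≤ Module.finrank ℤ (LinearMap.ker g) :=
    Submodule.finrank_mono hle
  have h2 := Submodule.finrank_quotient_add_finrank (LinearMap.ker g)
  rw [g.quotKerEquivRange.finrank_eq, Module.finrank_fin_fun] at h2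
  have h3 : 0 < Module.finrank ℤ (LinearMap.range g) := by
    have hne : (⟨g (Pi.single j 1), LinearMap.mem_range_self g _⟩ : LinearMap.range g) ≠ 0 := by
      intro h0
      have := congrArg Subtype.val h0
      simp [hg] at this
      exact hj this
    have : Nontrivial (LinearMap.range g) := ⟨_, _, hne⟩
    exact Module.finrank_pos
  omega

lemma le_finrank_span_of_span_ratVec {S : Set (Fin r → ℤ)}
    (hS : Submodule.span ℚ (ratVec '' S) = ⊤) : r ≤ Module.finrank ℤ (Submodule.span ℤ S) := by
  let b := Module.finBasis ℤ (Submodule.span ℤ S)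
  have hsub : ∀ v ∈ Submodule.span ℤ S,
      ratVec v ∈ Submodule.span ℚ (Set.range fun i => ratVec (b i : Fin r → ℤ)) := by
    intro v hv
    have h1 := congrArg Subtype.val (b.sum_repr ⟨v, hv⟩)
    have h2 : ratVec v = ∑ i, ((b.repr ⟨v, hv⟩ i : ℤ) : ℚ) • ratVec (b i : Fin r → ℤ) := by
      funext j
      have h3 := congrFun h1 j
      simp only [AddSubmonoidClass.coe_finsetSum, Submodule.coe_smul, Finset.sum_apply,
        Pi.smul_apply, smul_eq_mul] at h3
      simp only [ratVec, Finset.sum_apply, Pi.smul_apply, smul_eq_mul]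
      rw [← h3]
      push_cast
      rfl
    rw [h2]
    exact Submodule.sum_mem _ fun i _ => Submodule.smul_mem _ _ (Submodule.subset_span ⟨i, rfl⟩)
  have htop : Submodule.span ℚ (Set.range fun i => ratVec (b i : Fin r → ℤ)) = ⊤ := by
    rw [eq_top_iff, ← hS, Submodule.span_le]
    rintro _ ⟨v, hv, rfl⟩
    exact hsub v (Submodule.subset_span hv)
  have := finrank_range_le_card (R := ℚ) fun i => ratVec (b i : Fin r → ℤ)
  rw [Set.finrank, htop, finrank_top, Module.finrank_fin_fun, Fintype.card_fin] at this
  exact this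

lemma span_ratVec_eq_top_of_finrank {S : Set (Fin r → ℤ)}
    (h : Module.finrank ℤ (Submodule.span ℤ S) = r) : Submodule.span ℚ (ratVec '' S) = ⊤ := by
  by_contra hne
  obtain ⟨w, hw0, hw⟩ := exists_intVec_orthogonal hne
  exact (finrank_span_lt_of_orthogonal hw0 hw).ne h

lemma exists_intVec_orthogonal_of_finrank {S : Set (Fin r → ℤ)}
    (h : Module.finrank ℤ (Submodule.span ℤ S) ≠ r) :
    ∃ w : Fin r → ℤ, w ≠ 0 ∧ ∀ v ∈ S, v ⬝ᵥ w = 0 := by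
  refine exists_intVec_orthogonal fun htop => h (le_antisymm ?_
    (le_finrank_span_of_span_ratVec htop))
  simpa using Submodule.finrank_le (Submodule.span ℤ S)

/-- A nonzero vector orthogonal to `S` can be chosen primitive. -/
lemma exists_primitive_orthogonal {S : Set (Fin r → ℤ)}
    (h : Module.finrank ℤ (Submodule.span ℤ S) ≠ r) :
    ∃ w u : Fin r → ℤ, u ⬝ᵥ w = 1 ∧ ∀ v ∈ S, v ⬝ᵥ w = 0 := by
  obtain ⟨w₀, hw0, hw⟩ := exists_intVec_orthogonal_of_finrank h
  set I : Ideal ℤ := Ideal.span (Set.range w₀) with hI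
  obtain ⟨g, hg⟩ := (IsPrincipalIdealRing.principal I).principal
  have hdvd : ∀ j, ∃ x, w₀ j = x * g := fun j => by
    have : w₀ j ∈ I := Ideal.subset_span ⟨j, rfl⟩
    rw [hg] at this
    obtain ⟨x, hx⟩ := Submodule.mem_span_singleton.1 this
    exact ⟨x, hx.symm⟩
  choose w hwg using hdvd
  have hg0 : g ≠ 0 := by
    rintro rfl
    exact hw0 (funext fun j => by simp [hwg j])
  have hgI : g ∈ I := by
    rw [hg]
    exact Submodule.mem_span_singleton_self g
  obtain ⟨u, hu⟩ := (Submodule.mem_span_range_iff_exists_fun ℤ).1 hgI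
  have hdot : ∀ v : Fin r → ℤ, v ⬝ᵥ w₀ = v ⬝ᵥ w * g := by
    intro v
    rw [dotProduct, dotProduct, Finset.sum_mul]
    exact Finset.sum_congr rfl fun j _ => by rw [hwg j, mul_assoc]
  refine ⟨w, u, ?_, fun v hv => ?_⟩
  · have h1 : u ⬝ᵥ w * g = g := by
      rw [← hdot]
      exact hu
    exact mul_right_cancel₀ hg0 (h1.trans (one_mul g).symm)
  · have h1 := hw v hv
    rw [hdot] at h1
    exact (mul_eq_zero.1 h1).resolve_right hg0

lemma spansCoords_of_finrank {ι : Type*} {a : ι → Fin r → ℤ} {s : Finset ι}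
    (h : Module.finrank ℤ (Submodule.span ℤ (a '' s)) = r) : SpansCoords a s := by
  classical
  intro j
  have htop := span_ratVec_eq_top_of_finrank h
  have hmem : (Pi.single j 1 : Fin r → ℚ) ∈
      Submodule.span ℚ ((fun i => ratVec (a i)) '' (s : Set ι)) := by
    rw [← Set.image_image ratVec a, htop]
    trivial
  obtain ⟨c, hc⟩ := (Submodule.mem_span_image_finset_iff_exists_fun' ℚ).1 hmem
  refine ⟨fun i => c i, fun u => ?_⟩
  have h1 : (u j : ℚ) = ∑ i ∈ s, c i * ((a i ⬝ᵥ u : ℤ) : ℚ) := by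
    have h2 : ∀ l, (Pi.single j 1 : Fin r → ℚ) l = ∑ i ∈ s, c i * (a i l : ℚ) := fun l => by
      rw [← hc]
      simp [ratVec]
    calc (u j : ℚ) = ∑ l, (Pi.single j 1 : Fin r → ℚ) l * u l := by simp [Pi.single_apply]
      _ = ∑ l, ∑ i ∈ s, c i * (a i l : ℚ) * u l :=
        Finset.sum_congr rfl fun l _ => by rw [h2 l, Finset.sum_mul]
      _ = _ := by
        rw [Finset.sum_comm]
        refine Finset.sum_congr rfl fun i _ => ?_
        rw [dotProduct]
        push_cast
        rw [Finset.mul_sum]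
        exact Finset.sum_congr rfl fun l _ => by ring
  have h2 := congrArg (fun q : ℚ => (q : ℝ)) h1
  push_cast at h2 ⊢
  exact h2

end

section

variable {r : ℕ}

lemma AffFun.eval_intVec (f : AffFun r) (v : Fin r → ℤ) :
    f.eval (intVec v) = ((f.1 ⬝ᵥ v : ℤ) : ℂ) + f.2 := by
  rw [AffFun.eval, AffFun.vec, inner_intVec]
  norm_cast

lemma truncSum_eq_mul_cubeSum (Λ : Finset (AffFun r)) (k : Λ → ℕ) (N : ℕ)
    (y : EuclideanSpace ℝ (Fin r)) :
    truncSum Λ k N y = (-1) ^ (Finset.univ.filter fun f : Λ => k f = 0).card *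
      cubeSum (fun f : Λ => (f : AffFun r).1) (fun f => latticeFactor (f : AffFun r).2 (k f)) y N := by
  classical
  rw [truncSum, cubeSum, latticeBox, Finset.sum_filter]
  congr 1
  refine Finset.sum_congr rfl fun v _ => ?_
  simp only [AffFun.eval_intVec]
  split_ifs with h
  · rw [phase, Finset.prod_filter]
    congr 1
    refine Finset.prod_congr rfl fun f _ => ?_
    rcases Nat.eq_zero_or_pos (k f) with hk | hk
    · simp [latticeFactor, hk, h.2 f hk]
    · simp [latticeFactor, hk, hk.ne', h.1 f hk]
  · symm
    rw [not_and_or] at h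
    push Not at h
    refine mul_eq_zero_of_right _ ?_
    rcases h with ⟨f, hk, hf⟩ | ⟨f, hk, hf⟩
    · exact Finset.prod_eq_zero (Finset.mem_univ f) (by simp [latticeFactor, hk.ne', hf])
    · exact Finset.prod_eq_zero (Finset.mem_univ f) (by simp [latticeFactor, hk, hf])

lemma SpansCoords.span_intVec_eq_top {ι : Type*} {a : ι → Fin r → ℤ} {s : Finset ι}
    (h : SpansCoords a s) :
    Submodule.span ℝ ((fun i => intVec (a i)) '' (s : Set ι)) = ⊤ := by
  rw [eq_top_iff, ← (EuclideanSpace.basisFun (Fin r) ℝ).toBasis.span_eq, Submodule.span_le]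
  rintro _ ⟨j, rfl⟩
  obtain ⟨c, hc⟩ := h j
  have hj : (EuclideanSpace.basisFun (Fin r) ℝ).toBasis j = ∑ i ∈ s, c i • intVec (a i) := by
    ext l
    have h1 := hc (Pi.single l 1)
    simp only [dotProduct_single_one] at h1
    simp only [OrthonormalBasis.coe_toBasis, EuclideanSpace.basisFun_apply, WithLp.ofLp_sum,
      Finset.sum_apply, PiLp.smul_apply, intVec, smul_eq_mul]
    rw [← h1]
    simp [Pi.single_apply, eq_comm]
  rw [SetLike.mem_coe, hj]
  exact Submodule.sum_mem _ fun i hi =>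
    Submodule.smul_mem _ _ (Submodule.subset_span ⟨i, hi, rfl⟩)

/-- If `w` is primitive and orthogonal to all members of `Λ` except `d`, then an integral value of
`⟨y, w⟩` puts `y` in the union of translates of the span of the others. -/
lemma mem_realSpan_add_of_inner_eq_int {Λ : Finset (AffFun r)}
    (hsp : SpansCoords (fun f : Λ => (f : AffFun r).1) Finset.univ) {d : AffFun r}
    {w u : Fin r → ℤ} (huw : u ⬝ᵥ w = 1) (hw : ∀ g ∈ Λ, g ≠ d → g.1 ⬝ᵥ w = 0)
    {y : EuclideanSpace ℝ (Fin r)} {n : ℤ} (hn : inner ℝ y (intVec w) = (n : ℝ)) :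
    y ∈ (realSpan ((Λ : Set (AffFun r)) \ {d}) : Set (EuclideanSpace ℝ (Fin r))) +
      Set.range (intVec : (Fin r → ℤ) → EuclideanSpace ℝ (Fin r)) := by
  have hzero : ∀ z ∈ realSpan ((Λ : Set (AffFun r)) \ {d}), inner ℝ z (intVec w) = 0 := by
    intro z hz
    induction hz using Submodule.span_induction with
    | mem x hx =>
      obtain ⟨g, ⟨hg, hgd⟩, rfl⟩ := hx
      rw [AffFun.vec, inner_intVec, hw g hg hgd, Int.cast_zero]
    | zero => exact inner_zero_left _
    | add x x' _ _ hx hx' => rw [inner_add_left, hx, hx', add_zero]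
    | smul t x _ hx => rw [real_inner_smul_left, hx, mul_zero]
  have hu1 : inner ℝ (intVec u) (intVec w) = 1 := by
    rw [inner_intVec, huw, Int.cast_one]
  have hnu : intVec (n • u) = (n : ℝ) • intVec u := by
    ext j
    simp [intVec]
  set x := y - intVec (n • u) with hx
  have hxw : inner ℝ x (intVec w) = 0 := by
    rw [hx, inner_sub_left, hn, hnu, real_inner_smul_left, hu1, mul_one, sub_self]
  have hins : ∀ x : EuclideanSpace ℝ (Fin r), x ∈ Submodule.span ℝ
      (insert d.vec (AffFun.vec '' ((Λ : Set (AffFun r)) \ {d}))) := by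
    intro x
    have : x ∈ Submodule.span ℝ
        ((fun f : Λ => intVec (f : AffFun r).1) '' ((Finset.univ : Finset Λ) : Set Λ)) := by
      rw [hsp.span_intVec_eq_top]
      trivial
    refine Submodule.span_mono ?_ this
    rintro _ ⟨f, -, rfl⟩
    by_cases hf : (f : AffFun r) = d
    · exact Or.inl (by rw [← hf, AffFun.vec])
    · exact Or.inr ⟨f, ⟨f.2, hf⟩, rfl⟩
  obtain ⟨t, z, hz, hxz⟩ := Submodule.mem_span_insert.1 (hins x)
  obtain ⟨t', z', hz', hu⟩ := Submodule.mem_span_insert.1 (hins (intVec u))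
  have hd0 : inner ℝ d.vec (intVec w) ≠ 0 := by
    intro h0
    rw [hu, inner_add_left, real_inner_smul_left, h0, mul_zero, hzero z' hz', add_zero] at hu1
    exact zero_ne_one hu1
  rw [hxz, inner_add_left, real_inner_smul_left, hzero z hz, add_zero] at hxw
  rw [(mul_eq_zero.1 hxw).resolve_right hd0, zero_smul, zero_add] at hxz
  exact ⟨z, hz, intVec (n • u), ⟨_, rfl⟩, by simp only [← hxz, hx, sub_add_cancel]⟩

end

theorem mainTheorem3 (r : ℕ) (hr : 0 < r) (Λ : Finset (AffFun r))
    (hΛ : ∀ f ∈ Λ, f.1 ≠ 0) (hrank : vecRank (Λ : Set (AffFun r)) = r) (k : Λ → ℕ) :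
    (∀ y ∈ regularSet Λ k,
      Tendsto (fun N : ℕ => truncSum Λ k N y) atTop (𝓝 (latticeSum Λ k y))) ∧
    ContinuousOn (latticeSum Λ k) (regularSet Λ k) := by
  classical
  let a : Λ → Fin r → ℤ := fun f => (f : AffFun r).1
  let φ : Λ → ℤ → ℂ := fun f => latticeFactor (f : AffFun r).2 (k f)
  have himg : a '' ((Finset.univ : Finset Λ) : Set Λ) =
      (fun f : AffFun r => f.1) '' (Λ : Set (AffFun r)) := by
    ext v; simp [a]
  have hsp : SpansCoords a Finset.univ := spansCoords_of_finrank (by rw [himg]; exact hrank)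
  have himg' : ∀ d : Λ, a '' ((Finset.univ.erase d : Finset Λ) : Set Λ) =
      (fun f : AffFun r => f.1) '' ((Λ : Set (AffFun r)) \ {(d : AffFun r)}) := by
    intro d
    ext v
    constructor
    · rintro ⟨f, hf, rfl⟩
      refine ⟨f, ⟨f.2, fun h => ?_⟩, rfl⟩
      exact (Finset.mem_erase.1 (Finset.mem_coe.1 hf)).1 (Subtype.ext h)
    · rintro ⟨f, ⟨hf, hfd⟩, rfl⟩
      refine ⟨⟨f, hf⟩, Finset.mem_coe.2 (Finset.mem_erase.2 ⟨?_, Finset.mem_univ _⟩), rfl⟩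
      rintro rfl
      exact hfd rfl
  have hne : Nonempty Λ := by
    by_contra hempty
    rw [not_nonempty_iff] at hempty
    obtain ⟨c, hc⟩ := hsp ⟨0, hr⟩
    have := hc fun _ => 1
    simp at this
  let D : Finset Λ := Finset.univ.filter fun f => (f : AffFun r) ∈ indispensable Λ ∧ k f = 1
  have hwex : ∀ d : Λ, ∃ w u : Fin r → ℤ, d ∈ D →
      u ⬝ᵥ w = 1 ∧ ∀ g ∈ Λ, g ≠ (d : AffFun r) → g.1 ⬝ᵥ w = 0 := by
    intro d
    by_cases hd : d ∈ D
    · obtain ⟨w, u, huw, hw⟩ := exists_primitive_orthogonal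
        (Finset.mem_filter.1 hd).2.1.2
      exact ⟨w, u, fun _ => ⟨huw, fun g hg hgd => hw _ ⟨g, ⟨hg, hgd⟩, rfl⟩⟩⟩
    · exact ⟨0, 0, fun h => absurd h hd⟩
  choose w u hwu using hwex
  obtain ⟨T, hT, hlim⟩ := exists_continuous_tendsto_mul_cubeSum (a := a) (φ := φ) (w := w) (D := D)
    (e := fun f => if k f = 1 then 1 else 2) hne hsp
    (fun f => by by_cases h : k f = 1 <;> simp [h])
    (fun f => exists_norm_latticeFactor_le _ _)
    (fun d hd => by
      simp only [φ, (Finset.mem_filter.1 hd).2.2]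
      exact exists_norm_latticeFactor_sub_le _ _)
    (fun d hd i hi => (hwu d hd).2 i i.2 fun h => hi (Subtype.ext h))
    (fun f hf => by
      by_cases hk : k f = 1
      · left
        refine spansCoords_of_finrank ?_
        rw [himg' f]
        by_contra hrk
        exact hf (Finset.mem_filter.2 ⟨Finset.mem_univ f, ⟨f.2, hrk⟩, hk⟩)
      · right
        simp [hk])
  set P : EuclideanSpace ℝ (Fin r) → ℂ := fun y => ∏ d ∈ D, (1 - phase y (w d)) with hP
  have hPcont : Continuous P :=
    continuous_finsetProd _ fun d _ => continuous_const.sub (continuous_phase (w d))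
  have hP0 : ∀ y ∈ regularSet Λ k, P y ≠ 0 := by
    intro y hy
    refine Finset.prod_ne_zero_iff.2 fun d hd h0 => hy ?_
    obtain ⟨n, hn⟩ := phase_eq_one_iff.1 (sub_eq_zero.1 h0).symm
    exact Set.mem_iUnion.2 ⟨d, Set.mem_iUnion.2 ⟨(Finset.mem_filter.1 hd).2,
      mem_realSpan_add_of_inner_eq_int hsp (hwu d hd).1 (hwu d hd).2 hn⟩⟩
  set σ : ℂ := (-1) ^ (Finset.univ.filter fun f : Λ => k f = 0).card with hσ
  have hmain : ∀ y ∈ regularSet Λ k,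
      Tendsto (fun N : ℕ => truncSum Λ k N y) atTop (𝓝 (σ * ((P y)⁻¹ * T y))) := by
    intro y hy
    refine (((hlim y).const_mul (P y)⁻¹).const_mul σ).congr fun N => ?_
    rw [truncSum_eq_mul_cubeSum, inv_mul_cancel_left₀ (hP0 y hy)]
  have heq : ∀ y ∈ regularSet Λ k, latticeSum Λ k y = σ * ((P y)⁻¹ * T y) :=
    fun y hy => (hmain y hy).limUnder_eq
  refine ⟨fun y hy => by rw [heq y hy]; exact hmain y hy, ContinuousOn.congr ?_ heq⟩
  exact continuousOn_const.mul ((hPcont.continuousOn.inv₀ hP0).mul hT.continuousOn)
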